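/- Let $r\ge 1$, $\delta\ge 2$, $n$, $k$ be integers and write $n=w(r+\delta-1)+m$ with $0\le m<r+\delta-1$, and $k=ur+v$ with $0<v\le r$, where $w,m,u,v$ are nonnegative integers. For a linear code $\mathcal C\subseteq\mathbb F_q^n$, an $(r,\delta)$-repair set is a set $S\subseteq\{1,\dots,n\}$ with $|S|\le r+\delta-1$ such that for every $l\in S$ and every $L\subseteq S\setminus\{l\}$ with $|L|=\max\{|S|-(\delta-1),0\}$ the symbol $c_l$ is a linear function of $(c_i)_{i\in L}$, for $\mathbf c\in\mathcal C$ (so if $|S|\le\delta-1$, all codewords vanish on $S$). The code has $(r,\delta)_a$-locality if every coordinate lies in at least one $(r,\delta)$-repair set. Let $d_{\max}$ be the largest $d$ such that, for some prime power $q$, there exists a linear code over $\mathbb F_q$ of length $n$, dimension $k$ and minimum Hamming distance $d$ with $(r,\delta)_a$-locality. Assume $m>0$ and $v<r$ (that is, $r+\delta-1\nmid n$ and $r\nmid k$), $0<r<k\le n-\lceil k/r\rceil(\delta-1)$ and $v>\max\{m-\delta+1,\lfloor r/2\rfloor\}$. Then $d_{\max}$ exists in each of the following two cases, and $$d_{\max}=n-k+1-\left\lceil\frac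 kr\right\rceil(\delta-1)+\begin{cases}0,&\text{if } m\ge\delta\text{ and }u\ge\max\{2(r+\delta-1-m),\,r+\delta-1\},\\ \delta-1-m,&\text{if } m\le\delta-1\text{ and }u\ge 2r+\delta-1.\end{cases}$$ -/

import Mathlib

namespace LRC

/-- `S` is an `(r, δ)`-repair set of the linear code `C` of length `n`: `|S| ≤ r + δ - 1`, and each
symbol `c_l`, `l ∈ S`, is a linear function of the symbols in any `L ⊆ S \ {l}` with
`|L| = |S| - (δ - 1)`. The subtraction is truncated: if `|S| ≤ δ - 1`, then `L = ∅` and the condition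
says that all the codewords vanish on `S`, so that in every case the condition means that any `δ - 1`
erasures within `S` can be recovered from the rest of `S`. -/
def IsRepairSet {F : Type*} [Field F] {n : ℕ} (C : Submodule F (Fin n → F)) (r δ : ℕ)
    (S : Finset (Fin n)) : Prop :=
  S.card ≤ r + δ - 1 ∧
    ∀ l ∈ S, ∀ L ⊆ S.erase l, L.card = S.card - (δ - 1) →
      ∃ a : Fin n → F, ∀ c ∈ C, c l = ∑ i ∈ L, a i * c i

/-- All-symbol `(r, δ)`-locality: every coordinate lies in some `(r, δ)`-repair set. -/
def HasLocality {F : Type*} [Field F] {n : ℕ} (C : Submodule F (Fin n → F)) (r δ : ℕ) : Prop :=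
  ∀ i : Fin n, ∃ S : Finset (Fin n), i ∈ S ∧ IsRepairSet C r δ S

/-- `d` is the minimum Hamming distance of `C`. -/
def IsMinDist {F : Type*} [Field F] [DecidableEq F] {n : ℕ} (C : Submodule F (Fin n → F))
    (d : ℕ) : Prop :=
  IsLeast {t : ℕ | ∃ x ∈ C, ∃ y ∈ C, x ≠ y ∧ hammingDist x y = t} d

/-- The set of all `d` for which, over some finite field, there is a linear `[n, k, d]` code with
all-symbol `(r, δ)`-locality (as integers). -/
def distances (n k r δ : ℕ) : Set ℤ :=
  {z : ℤ | ∃ (F : Type) (_ : Field F) (_ : Fintype F) (_ : DecidableEq F)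
    (C : Submodule F (Fin n → F)) (d : ℕ),
      Module.finrank F C = k ∧ HasLocality C r δ ∧ IsMinDist C d ∧ z = (d : ℤ)}

/-- `z` is `d_max`: the largest `d` such that a linear `[n, k, d]` code with all-symbol
`(r, δ)`-locality exists over some finite field. -/
def IsDMax (n k r δ : ℕ) (z : ℤ) : Prop :=
  IsGreatest (distances n k r δ) z

end LRC

/-
Upper bound. Read the coordinates of a code of dimension `k = u * r + v` as vectors spanning its
dual space. A subspace `W` of dimension less than `k` containing `s` of them is killed by a nonzero
codeword vanishing at `s` places, so a large distance keeps flats small. Adjoining a repair set to a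
subspace not containing it raises the nullity (size of the flat minus dimension) by at least
`ε = δ - 1`; hence a distance above the bound forces every subspace of dimension less than
`j * r + v`, `j ≤ u`, to have nullity less than `j * ε + min m ε`. Then in a minimal cover of the
coordinates by closures of repair sets no member is spanned by `u` others, few members cannot have
an unusually large union, and few members cannot have an unusually small rank. So, if the cover has
`p` members, `n` lies in a window around `p * (r + ε)` which `w * (r + ε) + m` misses.

Construction. Split the coordinates into `w` blocks of size `r + ε` and one of size `m`, place in
each a Reed–Solomon configuration of dimension `r`, respectively `m - ε`, and use the vectors of the
direct sum as evaluation points of a Gabidulin code. A codeword vanishing on a set of rank at least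
`k` is zero, and the sets of rank less than `k` are small enough for the bound to be attained.
-/

namespace LRC

open Finset Module Submodule

section Span

variable {F V ι : Type*} [Field F] [AddCommGroup V] [Module F V] {x : ι → V}

/-- The span of the vectors of the configuration `x` with an index in `S`. -/
def spanOn (F : Type*) {V ι : Type*} [Field F] [AddCommGroup V] [Module F V] (x : ι → V)
    (S : Finset ι) : Submodule F V :=
  span F (x '' S)

lemma mem_spanOn {S : Finset ι} {i : ι} (h : i ∈ S) : x i ∈ spanOn F x S :=
  subset_span ⟨i, h, rfl⟩

lemma spanOn_le_iff {S : Finset ι} {W : Submodule F V} : spanOn F x S ≤ W ↔ ∀ i ∈ S, x i ∈ W := by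
  simp [spanOn, span_le, Set.subset_def]

lemma spanOn_mono {S T : Finset ι} (h : S ⊆ T) : spanOn F x S ≤ spanOn F x T :=
  spanOn_le_iff.2 fun _ hi => mem_spanOn (h hi)

lemma spanOn_union [DecidableEq ι] (S T : Finset ι) :
    spanOn F x (S ∪ T) = spanOn F x S ⊔ spanOn F x T := by
  rw [spanOn, coe_union, Set.image_union, span_union]
  rfl

lemma spanOn_comp {V' : Type*} [AddCommGroup V'] [Module F V'] (f : V →ₗ[F] V') (x : ι → V)
    (S : Finset ι) : spanOn F (f ∘ x) S = (spanOn F x S).map f := by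
  rw [spanOn, Set.image_comp, span_image]
  rfl

lemma finrank_spanOn_le_card (x : ι → V) (S : Finset ι) : finrank F (spanOn F x S) ≤ #S := by
  classical
  have h := finrank_span_finset_le_card (R := F) (S.image x)
  rw [coe_image] at h
  exact h.trans card_image_le

lemma exists_notMem_of_finrank_lt (hx : span F (Set.range x) = ⊤) {W : Submodule F V}
    (hW : finrank F W < finrank F V) : ∃ j, x j ∉ W := by
  by_contra! hall
  have htop : W = ⊤ := top_le_iff.1 (hx ▸ span_le.2 (Set.range_subset_iff.2 hall))
  rw [htop, finrank_top] at hW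
  exact hW.false

/-- The repair sets of a code, read on the vectors representing its coordinates: `S` has at most
`r + ε` elements, and any `ε` of its vectors lie in the span of the remaining ones. The paper's `δ`
is `ε + 1`. -/
structure IsVectorRepairSet (F : Type*) {V ι : Type*} [Field F] [AddCommGroup V] [Module F V]
    (x : ι → V) (r ε : ℕ) (S : Finset ι) : Prop where
  card_le : #S ≤ r + ε
  spanOn_le : ∀ L ⊆ S, #L = #S - ε → spanOn F x S ≤ spanOn F x L

lemma isVectorRepairSet_singleton (i : ι) : IsVectorRepairSet F x 1 0 {i} where
  card_le := by simp
  spanOn_le L hL hLc := by rw [eq_of_subset_of_card_le hL (by omega)]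

namespace IsVectorRepairSet

variable {r ε : ℕ} {S L : Finset ι}

lemma spanOn_le_of_le_card (hS : IsVectorRepairSet F x r ε S) (hL : L ⊆ S) (hc : #S - ε ≤ #L) :
    spanOn F x S ≤ spanOn F x L := by
  obtain ⟨L', hL', hc'⟩ := exists_subset_card_eq hc
  exact (hS.spanOn_le L' (hL'.trans hL) hc').trans (spanOn_mono hL')

lemma comp {V' : Type*} [AddCommGroup V'] [Module F V'] (hS : IsVectorRepairSet F x r ε S)
    (f : V →ₗ[F] V') : IsVectorRepairSet F (f ∘ x) r ε S where
  card_le := hS.card_le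
  spanOn_le L hL hLc := by
    rw [spanOn_comp, spanOn_comp]
    exact map_mono (hS.spanOn_le L hL hLc)

lemma finrank_spanOn_le [FiniteDimensional F V] (hS : IsVectorRepairSet F x r ε S) :
    finrank F (spanOn F x S) ≤ r := by
  obtain ⟨L, hL, hc⟩ := exists_subset_card_eq (Nat.sub_le #S ε)
  calc finrank F (spanOn F x S) ≤ finrank F (spanOn F x L) := finrank_mono (hS.spanOn_le L hL hc)
    _ ≤ #L := finrank_spanOn_le_card x L
    _ ≤ r := by have := hS.card_le; omega

end IsVectorRepairSet

lemma finrank_sup_spanOn_le_mul [FiniteDimensional F V] {r ε : ℕ} {I : Finset (Finset ι)}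
    (hI : ∀ S ∈ I, IsVectorRepairSet F x r ε S) : finrank F ↥(I.sup (spanOn F x)) ≤ #I * r := by
  classical
  induction I using Finset.induction_on with
  | empty => simp
  | insert S I hSI ih =>
    have hrest := ih fun T hT => hI T (mem_insert_of_mem hT)
    have hS := (hI S (mem_insert_self S I)).finrank_spanOn_le
    have hadd := finrank_add_le_finrank_add_finrank (spanOn F x S) (I.sup (spanOn F x))
    rw [sup_insert, card_insert_of_notMem hSI, add_one_mul]
    omega

lemma finrank_sup_spanOn_add_mul_le [FiniteDimensional F V] {r ε : ℕ} {I J : Finset (Finset ι)}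
    (hI : ∀ S ∈ I, IsVectorRepairSet F x r ε S) (hJ : J ⊆ I) :
    finrank F ↥(I.sup (spanOn F x)) + #J * r ≤ finrank F ↥(J.sup (spanOn F x)) + #I * r := by
  classical
  have hsup : J.sup (spanOn F x) ⊔ (I \ J).sup (spanOn F x) = I.sup (spanOn F x) := by
    rw [← sup_union, union_sdiff_of_subset hJ]
  have hadd := finrank_add_le_finrank_add_finrank (J.sup (spanOn F x)) ((I \ J).sup (spanOn F x))
  have hdiff := finrank_sup_spanOn_le_mul fun S hS => hI S (sdiff_subset (t := J) hS)
  have hcard : #I * r = #(I \ J) * r + #J * r := by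
    rw [← add_mul, card_sdiff_add_card_eq_card hJ]
  rw [hsup] at hadd
  omega

end Span

section Flat

variable {F V ι : Type*} [Field F] [AddCommGroup V] [Module F V] [Fintype ι] {x : ι → V}

open scoped Classical in
/-- The flat cut out by the subspace `W`: the indices of the vectors of `x` lying in `W`. -/
noncomputable def flat (x : ι → V) (W : Submodule F V) : Finset ι :=
  {i | x i ∈ W}

@[simp] lemma mem_flat {W : Submodule F V} {i : ι} : i ∈ flat x W ↔ x i ∈ W := by
  simp [flat]

lemma flat_mono {W W' : Submodule F V} (h : W ≤ W') : flat x W ⊆ flat x W' :=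
  fun _ hi => mem_flat.2 (h (mem_flat.1 hi))

lemma subset_flat_iff {S : Finset ι} {W : Submodule F V} : S ⊆ flat x W ↔ spanOn F x S ≤ W := by
  simp [subset_iff, spanOn_le_iff]

lemma card_flat_add_card_sdiff_le [DecidableEq ι] (x : ι → V) (S : Finset ι) (W : Submodule F V) :
    #(flat x W) + #(S \ flat x W) ≤ #(flat x (W ⊔ spanOn F x S)) := by
  rw [← card_union_of_disjoint disjoint_sdiff]
  exact card_le_card (union_subset (flat_mono le_sup_left)
    (sdiff_subset.trans (subset_flat_iff.2 le_sup_right)))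

variable [FiniteDimensional F V]

lemma IsVectorRepairSet.finrank_sup_add_le [DecidableEq ι] {r ε : ℕ} {S : Finset ι}
    (hS : IsVectorRepairSet F x r ε S) {W : Submodule F V} (hW : ¬ spanOn F x S ≤ W) :
    finrank F ↥(W ⊔ spanOn F x S) + ε ≤ finrank F W + #(S \ flat x W) := by
  have hsplit : #(S ∩ flat x W) + #(S \ flat x W) = #S := card_inter_add_card_sdiff _ _
  have hinter : spanOn F x (S ∩ flat x W) ≤ W := subset_flat_iff.1 inter_subset_right
  have hε : ε ≤ #(S \ flat x W) := by
    by_contra! hlt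
    exact hW ((hS.spanOn_le_of_le_card inter_subset_left (by omega)).trans hinter)
  obtain ⟨D, hD, hDc⟩ := exists_subset_card_eq (Nat.sub_le #(S \ flat x W) ε)
  have hrecover : spanOn F x S ≤ W ⊔ spanOn F x D := by
    refine (hS.spanOn_le (S ∩ flat x W ∪ D)
      (union_subset inter_subset_left (hD.trans sdiff_subset)) ?_).trans ?_
    · rw [card_union_of_disjoint
        (disjoint_of_subset_right hD (disjoint_sdiff_inter S (flat x W)).symm)]
      omega
    · rw [spanOn_union]
      exact sup_le_sup_right hinter _
  have hmono := finrank_mono (sup_le le_sup_left hrecover : W ⊔ spanOn F x S ≤ W ⊔ spanOn F x D)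
  have hadd := finrank_add_le_finrank_add_finrank W (spanOn F x D)
  have hcard := finrank_spanOn_le_card (F := F) x D
  omega

lemma exists_le_finrank_of_covered {r ε : ℕ} (hx : span F (Set.range x) = ⊤)
    (hcov : ∀ i, ∃ S, i ∈ S ∧ IsVectorRepairSet F x r ε S) (t : ℕ) (W : Submodule F V)
    (hW : finrank F W + t * r < finrank F V) :
    ∃ W' : Submodule F V, finrank F W + t ≤ finrank F W' ∧ finrank F W' ≤ finrank F W + t * r ∧
      #(flat x W) + finrank F W' + t * ε ≤ #(flat x W') + finrank F W := by
  classical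
  induction t generalizing W with
  | zero => exact ⟨W, by omega, by omega, by omega⟩
  | succ t ih =>
    obtain ⟨j, hj⟩ := exists_notMem_of_finrank_lt hx (W := W) (by omega)
    obtain ⟨S, hjS, hS⟩ := hcov j
    have hSW : ¬ spanOn F x S ≤ W := fun h => hj (h (mem_spanOn hjS))
    have hlt : finrank F W < finrank F ↥(W ⊔ spanOn F x S) :=
      finrank_lt_finrank_of_lt (left_lt_sup.2 hSW)
    have hle := finrank_add_le_finrank_add_finrank W (spanOn F x S)
    have hSr := hS.finrank_spanOn_le
    have hnull := hS.finrank_sup_add_le hSW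
    have hflat := card_flat_add_card_sdiff_le x S W
    rw [add_one_mul] at hW
    obtain ⟨W', hlow, hup, hnull'⟩ := ih (W ⊔ spanOn F x S) (by omega)
    refine ⟨W', by omega, ?_, ?_⟩ <;> rw [add_one_mul] <;> omega

lemma exists_finrank_add_one_eq (hx : span F (Set.range x) = ⊤) {W : Submodule F V}
    (hW : finrank F W < finrank F V) :
    ∃ H : Submodule F V, finrank F H + 1 = finrank F V ∧
      #(flat x W) + finrank F V ≤ #(flat x H) + finrank F W + 1 := by
  obtain ⟨H, hlow, hup, hnull⟩ := exists_le_finrank_of_covered hx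
    (fun i => ⟨{i}, mem_singleton_self i, isVectorRepairSet_singleton i⟩)
    (finrank F V - 1 - finrank F W) W (by omega)
  exact ⟨H, by omega, by omega⟩

end Flat

lemma card_biUnion_insert {κ ι : Type*} [DecidableEq κ] [DecidableEq ι] (f : κ → Finset ι) (a : κ)
    (s : Finset κ) : #((insert a s).biUnion f) = #(s.biUnion f) + #(f a \ s.biUnion f) := by
  rw [biUnion_insert, union_comm, ← union_sdiff_self_eq_union,
    card_union_of_disjoint disjoint_sdiff]

section Families

variable {F V ι : Type*} [Field F] [AddCommGroup V] [Module F V] {x : ι → V}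
  {r ε t : ℕ} {A I : Finset (Finset ι)} {S : Finset ι}

/-- No member of the family `A` is spanned by at most `t` other members. -/
def IsIrredundant (F : Type*) {V ι : Type*} [Field F] [AddCommGroup V] [Module F V] (x : ι → V)
    (t : ℕ) (A : Finset (Finset ι)) : Prop :=
  ∀ I ⊆ A, #I ≤ t → ∀ S ∈ A, S ∉ I → ¬ spanOn F x S ≤ I.sup (spanOn F x)

variable [Fintype ι]

/-- The closure of `S` in the linear matroid of the configuration `x`. -/
noncomputable def closureOn (F : Type*) {V ι : Type*} [Field F] [AddCommGroup V] [Module F V]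
    [Fintype ι] (x : ι → V) (S : Finset ι) : Finset ι :=
  flat x (spanOn F x S)

lemma mem_closureOn {i : ι} : i ∈ closureOn F x S ↔ x i ∈ spanOn F x S :=
  mem_flat

lemma subset_closureOn (x : ι → V) (S : Finset ι) : S ⊆ closureOn F x S :=
  subset_flat_iff.2 le_rfl

variable [DecidableEq ι]

lemma biUnion_closureOn_subset_flat (x : ι → V) (I : Finset (Finset ι)) :
    I.biUnion (closureOn F x) ⊆ flat x (I.sup (spanOn F x)) :=
  biUnion_subset.2 fun _ hS => flat_mono (le_sup (f := spanOn F x) hS)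

lemma exists_subset_biUnion_closureOn {G : Finset ι} (hG : G ⊆ I.biUnion (closureOn F x)) :
    ∃ K ⊆ I, #K ≤ #G ∧ G ⊆ K.biUnion (closureOn F x) := by
  choose! f hfI hf using fun i (hi : i ∈ G) => mem_biUnion.1 (hG hi)
  exact ⟨G.image f, image_subset_iff.2 hfI, card_image_le,
    fun i hi => mem_biUnion.2 ⟨f i, mem_image_of_mem f hi, hf i hi⟩⟩

lemma exists_isIrredundant_one_cover [Nontrivial V] (hx : span F (Set.range x) = ⊤)
    (hcov : ∀ i, ∃ S, i ∈ S ∧ IsVectorRepairSet F x r ε S) :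
    ∃ A : Finset (Finset ι), (∀ S ∈ A, IsVectorRepairSet F x r ε S) ∧ IsIrredundant F x 1 A ∧
      A.biUnion (closureOn F x) = univ := by
  classical
  obtain ⟨A, hmin⟩ := exists_minimal_of_wellFoundedLT
    (fun A : Finset (Finset ι) => (∀ S ∈ A, IsVectorRepairSet F x r ε S) ∧
      ∀ i, ∃ S ∈ A, i ∈ closureOn F x S)
    ⟨({S | IsVectorRepairSet F x r ε S} : Finset (Finset ι)), by simp, fun i => by
      obtain ⟨S, hiS, hS⟩ := hcov i
      exact ⟨S, by simpa using hS, subset_closureOn x S hiS⟩⟩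
  obtain ⟨hA, hcover⟩ := hmin.prop
  have hanti : ∀ S ∈ A, ∀ T ∈ A, S ≠ T → ¬ spanOn F x S ≤ spanOn F x T := by
    intro S hS T hT hne hle
    refine hmin.not_prop_of_lt (erase_ssubset hS) ⟨fun R hR => hA R (mem_of_mem_erase hR), ?_⟩
    intro i
    obtain ⟨R, hR, hiR⟩ := hcover i
    obtain rfl | hRS := eq_or_ne R S
    · exact ⟨T, mem_erase.2 ⟨hne.symm, hT⟩, flat_mono hle hiR⟩
    · exact ⟨R, mem_erase.2 ⟨hRS, hR⟩, hiR⟩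
  have hbot : ∀ S ∈ A, ¬ spanOn F x S ≤ ⊥ := by
    intro S hS hle
    obtain ⟨j, hj⟩ : ∃ j, x j ≠ 0 := by
      by_contra! hzero
      refine bot_ne_top (α := Submodule F V) (le_antisymm bot_le (hx ▸ span_le.2 ?_))
      exact Set.range_subset_iff.2 fun j => (mem_bot F).2 (hzero j)
    obtain ⟨T, hT, hjT⟩ := hcover j
    refine hanti S hS T hT ?_ (hle.trans bot_le)
    rintro rfl
    exact hj ((mem_bot F).1 (hle (mem_closureOn.1 hjT)))
  refine ⟨A, hA, fun I hI hIc S hS hSI => ?_, by ext i; simpa using hcover i⟩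
  obtain hI0 | hI1 := Nat.le_one_iff_eq_zero_or_eq_one.1 hIc
  · rw [card_eq_zero.1 hI0, sup_empty]
    exact hbot S hS
  · obtain ⟨T, rfl⟩ := card_eq_one.1 hI1
    rw [sup_singleton]
    exact hanti S hS T (hI (mem_singleton_self T)) (notMem_singleton.1 hSI)

lemma IsIrredundant.finrank_add_le_card_biUnion [FiniteDimensional F V]
    (hA : ∀ S ∈ A, IsVectorRepairSet F x r ε S) (hirr : IsIrredundant F x t A) (hI : I ⊆ A)
    (ht : #I ≤ t + 1) :
    finrank F ↥(I.sup (spanOn F x)) + #I * ε ≤ #(I.biUnion (closureOn F x)) := by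
  induction I using Finset.induction_on with
  | empty => simp
  | insert S I hSI ih =>
    obtain ⟨hSA, hIA⟩ := insert_subset_iff.1 hI
    rw [card_insert_of_notMem hSI] at ht
    have hrest := ih hIA (by omega)
    have hS := (hA S hSA).finrank_sup_add_le (hirr I hIA (by omega) S hSA hSI)
    have hnew : #(S \ flat x (I.sup (spanOn F x))) ≤
        #(closureOn F x S \ I.biUnion (closureOn F x)) :=
      card_le_card (sdiff_subset_sdiff (subset_closureOn x S) (biUnion_closureOn_subset_flat x I))
    rw [sup_insert, sup_comm, card_biUnion_insert, card_insert_of_notMem hSI, add_one_mul]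
    omega

end Families

section Counting

lemma card_sdiff_add_card_sdiff_le {ι : Type*} [DecidableEq ι] (S : Finset ι) {C P Q : Finset ι}
    (h : C ⊆ P ∪ Q) : #(S \ P) + #(S \ Q) ≤ #S + #(S \ C) := by
  rw [← card_union_add_card_inter, ← sdiff_union_distrib]
  exact add_le_add (card_le_card (union_subset sdiff_subset sdiff_subset))
    (card_le_card (sdiff_subset_sdiff Subset.rfl h))

lemma exists_subset_card_mul_add_le_card_biUnion {κ ι : Type*} [DecidableEq ι]
    (f : κ → Finset ι) (N : ℕ) (I : Finset κ) (t : ℕ) (ht : t ≤ #(I.biUnion f) - #I * N) :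
    ∃ J ⊆ I, #J ≤ t ∧ #J * N + t ≤ #(J.biUnion f) := by
  classical
  induction I using Finset.induction_on generalizing t with
  | empty => exact ⟨∅, Subset.rfl, by simp, by simpa using ht⟩
  | insert a I haI ih =>
    rw [card_insert_of_notMem haI, card_biUnion_insert, add_one_mul] at ht
    obtain rfl | htpos := t.eq_zero_or_pos
    · exact ⟨∅, empty_subset _, by simp, by simp⟩
    obtain hgain | hgain := le_or_gt #(f a \ I.biUnion f) N
    · obtain ⟨J, hJ, hcard, hunion⟩ := ih t (by omega)
      exact ⟨J, hJ.trans (subset_insert a I), hcard, hunion⟩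
    · obtain ⟨J, hJ, hcard, hunion⟩ := ih (t - (#(f a \ I.biUnion f) - N)) (by omega)
      have hmono : #(f a \ I.biUnion f) ≤ #(f a \ J.biUnion f) :=
        card_le_card (sdiff_subset_sdiff Subset.rfl (biUnion_subset_biUnion_of_subset_left f hJ))
      have haJ : a ∉ J := fun h => haI (hJ h)
      refine ⟨insert a J, insert_subset_insert a hJ, ?_, ?_⟩
      · rw [card_insert_of_notMem haJ]
        omega
      · rw [card_insert_of_notMem haJ, card_biUnion_insert, add_one_mul]
        omega

variable {F V ι : Type*} [Field F] [AddCommGroup V] [Module F V] [Fintype ι] {x : ι → V}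
  {r ε v μ u t : ℕ} {A I : Finset (Finset ι)} {S : Finset ι}

/-- Every subspace of dimension less than `j * r + v`, `j ≤ u`, has nullity less than `j * ε + μ`,
where the nullity of `W` is the number of vectors of `x` in `W` minus the dimension of `W`. The
coordinates of a code of dimension `u * r + v` with too large a distance have this property. -/
def HasNullityBound (F : Type*) {V ι : Type*} [Field F] [AddCommGroup V] [Module F V] [Fintype ι]
    (x : ι → V) (r ε v μ u : ℕ) : Prop :=
  ∀ (W : Submodule F V), ∀ j ≤ u, finrank F W < j * r + v →
    #(flat x W) < finrank F W + j * ε + μ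

variable [FiniteDimensional F V]

namespace HasNullityBound

lemma le_finrank_sup (h : HasNullityBound F x r ε v μ u) (hvr : v ≤ r) (hμ : μ ≤ ε)
    (hA : ∀ S ∈ A, IsVectorRepairSet F x r ε S) (hirr : IsIrredundant F x t A) (hI : I ⊆ A)
    (ht : #I ≤ t + 1) (hu : #I ≤ u + 1) : #I * r + v ≤ finrank F ↥(I.sup (spanOn F x)) + r := by
  classical
  by_contra! hlt
  rcases hj : #I with _ | j
  · rw [hj] at hlt
    omega
  have hunion := hirr.finrank_add_le_card_biUnion hA hI ht
  have hflat := card_le_card (biUnion_closureOn_subset_flat (F := F) x I)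
  rw [hj, add_one_mul] at hlt hunion
  have hnull := h (I.sup (spanOn F x)) j (by omega) (by omega)
  omega

lemma le_card_sdiff_flat [DecidableEq ι] (h : HasNullityBound F x r ε v μ u) (hvr : v ≤ r)
    (hμ : μ ≤ ε) (hA : ∀ S ∈ A, IsVectorRepairSet F x r ε S)
    (hirr : IsIrredundant F x t A) (hI : I ⊆ A) (ht : #I ≤ t) (hu : #I ≤ u) (hS : S ∈ A)
    (hSI : S ∉ I) : v + ε ≤ #(S \ flat x (I.sup (spanOn F x))) := by
  have hcard := card_insert_of_notMem hSI
  have hrank := h.le_finrank_sup hvr hμ hA hirr (insert_subset hS hI) (by omega) (by omega)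
  have hrankI := finrank_sup_spanOn_le_mul fun T hT => hA T (hI hT)
  have hnull := (hA S hS).finrank_sup_add_le (hirr I hI ht S hS hSI)
  rw [hcard, add_one_mul, sup_insert, sup_comm] at hrank
  omega

lemma isIrredundant_succ (h : HasNullityBound F x r ε v μ u) (hv : 0 < v) (hvr : v ≤ r)
    (hμ : μ ≤ ε) (hrμ : r + μ ≤ 2 * v + ε) (hA : ∀ S ∈ A, IsVectorRepairSet F x r ε S)
    (ht : 1 ≤ t) (htu : t < u) (hirr : IsIrredundant F x t A) : IsIrredundant F x (t + 1) A := by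
  classical
  intro I hI hIc S hS hSI hle
  obtain hIt | hIt := le_or_gt #I t
  · exact hirr I hI hIt S hS hSI hle
  -- `S` has at least `v + ε` elements outside each of the flats of `{T}` and `I \ {T}`, hence at
  -- least `2 * v + ε - r` outside the union of the members of `I`: too many for the nullity bound.
  obtain ⟨T, hT⟩ := card_pos.1 (show 0 < #I by omega)
  have hcardT := card_erase_add_one hT
  have hST : S ∉ ({T} : Finset (Finset ι)) := by
    rw [mem_singleton]
    rintro rfl
    exact hSI hT
  have hgainT := h.le_card_sdiff_flat hvr hμ hA hirr (singleton_subset_iff.2 (hI hT))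
    (by simpa using ht) (by rw [card_singleton]; omega) hS hST
  have hgainI := h.le_card_sdiff_flat hvr hμ hA hirr ((erase_subset T I).trans hI)
    (by omega) (by omega) hS fun hmem => hSI (mem_of_mem_erase hmem)
  set P := flat x (({T} : Finset (Finset ι)).sup (spanOn F x))
  set Q := flat x ((I.erase T).sup (spanOn F x))
  have hPQ : I.biUnion (closureOn F x) ⊆ P ∪ Q := by
    rw [← insert_erase hT, biUnion_insert, ← singleton_biUnion (t := closureOn F x) (a := T)]
    exact union_subset_union (biUnion_closureOn_subset_flat x _)
      (biUnion_closureOn_subset_flat x _)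
  have hsplit := card_sdiff_add_card_sdiff_le S hPQ
  have hspan : #(I.biUnion (closureOn F x)) + #(S \ I.biUnion (closureOn F x)) ≤
      #(flat x (I.sup (spanOn F x))) := by
    rw [← card_union_of_disjoint disjoint_sdiff]
    exact card_le_card (union_subset (biUnion_closureOn_subset_flat x I)
      (sdiff_subset.trans (subset_flat_iff.2 hle)))
  have hunion := hirr.finrank_add_le_card_biUnion hA hI hIc
  have hrankI := finrank_sup_spanOn_le_mul fun T hT => hA T (hI hT)
  have hnull := h (I.sup (spanOn F x)) #I (by omega) (by omega)
  have hScard := (hA S hS).card_le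
  omega

lemma isIrredundant (h : HasNullityBound F x r ε v μ u) (hv : 0 < v) (hvr : v ≤ r) (hμ : μ ≤ ε)
    (hrμ : r + μ ≤ 2 * v + ε) (hA : ∀ S ∈ A, IsVectorRepairSet F x r ε S) (hu : 1 ≤ u)
    (hirr : IsIrredundant F x 1 A) : IsIrredundant F x u A := by
  suffices ∀ t, 1 ≤ t → t ≤ u → IsIrredundant F x t A from this u hu le_rfl
  intro t ht
  induction t, ht using Nat.le_induction with
  | base => exact fun _ => hirr
  | succ t ht ih =>
    exact fun htu => h.isIrredundant_succ hv hvr hμ hrμ hA ht htu (ih (by omega))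

end HasNullityBound

lemma IsVectorRepairSet.exists_subset_finrank_sup_add_le [DecidableEq ι]
    (hS : IsVectorRepairSet F x r ε S) {b : ℕ} (hb : #(S \ I.biUnion (closureOn F x)) + b ≤ r + ε) :
    ∃ K ⊆ I, #K ≤ b ∧ ∀ W : Submodule F V, K.sup (spanOn F x) ≤ W → ¬ spanOn F x S ≤ W →
      finrank F ↥(W ⊔ spanOn F x S) + b ≤ finrank F W + r := by
  have hScard := hS.card_le
  have hsplit := card_inter_add_card_sdiff S (I.biUnion (closureOn F x))
  obtain ⟨G, hG, hGc⟩ := exists_subset_card_eq (s := S ∩ I.biUnion (closureOn F x))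
    (n := b - (r + ε - #S)) (by omega)
  obtain ⟨K, hK, hKc, hGK⟩ := exists_subset_biUnion_closureOn (hG.trans inter_subset_right)
  refine ⟨K, hK, by omega, fun W hKW hSW => ?_⟩
  have hGW : G ⊆ flat x W :=
    (hGK.trans (biUnion_closureOn_subset_flat x K)).trans (flat_mono hKW)
  have hnull := hS.finrank_sup_add_le hSW
  have hsdiff : #(S \ flat x W) ≤ #(S \ G) := card_le_card (sdiff_subset_sdiff Subset.rfl hGW)
  rw [card_sdiff_of_subset (hG.trans inter_subset_left)] at hsdiff
  omega

lemma IsIrredundant.exists_subset_finrank_sup_add_le [DecidableEq ι] {N : ℕ}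
    (hA : ∀ S ∈ A, IsVectorRepairSet F x r ε S) (hirr : IsIrredundant F x N A) (hI : I ⊆ A) (t : ℕ)
    (htN : 2 * t ≤ N + 1) (ht : t ≤ #I * (r + ε) - #(I.biUnion (closureOn F x))) :
    ∃ J ⊆ I, #J ≤ 2 * t ∧ finrank F ↥(J.sup (spanOn F x)) + t ≤ #J * r := by
  induction I using Finset.induction_on generalizing t with
  | empty => exact ⟨∅, Subset.rfl, by simp, by simpa using ht⟩
  | insert S I hSI ih =>
    obtain ⟨hSA, hIA⟩ := insert_subset_iff.1 hI
    rw [card_insert_of_notMem hSI, card_biUnion_insert, add_one_mul] at ht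
    obtain rfl | htpos := t.eq_zero_or_pos
    · exact ⟨∅, empty_subset _, by simp, by simp⟩
    obtain hgain | hgain := le_or_gt (r + ε) #(closureOn F x S \ I.biUnion (closureOn F x))
    · obtain ⟨J, hJ, hcard, hrank⟩ := ih hIA t htN (by omega)
      exact ⟨J, hJ.trans (subset_insert S I), hcard, hrank⟩
    have hmono : #(S \ I.biUnion (closureOn F x)) ≤
        #(closureOn F x S \ I.biUnion (closureOn F x)) :=
      card_le_card (sdiff_subset_sdiff (subset_closureOn x S) Subset.rfl)
    obtain ⟨b, hbpos, hbt, hb, hrest⟩ : ∃ b, 0 < b ∧ b ≤ t ∧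
        b + #(closureOn F x S \ I.biUnion (closureOn F x)) ≤ r + ε ∧
        t - b ≤ #I * (r + ε) - #(I.biUnion (closureOn F x)) :=
      ⟨min t (r + ε - #(closureOn F x S \ I.biUnion (closureOn F x))), by omega, by omega,
        by omega, by omega⟩
    obtain ⟨J, hJ, hJc, hJrank⟩ := ih hIA (t - b) (by omega) hrest
    obtain ⟨K, hK, hKc, hKrank⟩ := (hA S hSA).exists_subset_finrank_sup_add_le (I := I) (b := b)
      (by omega)
    have hJK : J ∪ K ⊆ I := union_subset hJ hK
    have hSJK : S ∉ J ∪ K := fun h => hSI (hJK h)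
    have hJKc := card_union_le J K
    have hJKrank := finrank_sup_spanOn_add_mul_le (fun R hR => hA R (hIA (hJK hR)))
      (subset_union_left (s₁ := J) (s₂ := K))
    have hSrank := hKrank _ (sup_mono (subset_union_right (s₁ := J)))
      (hirr (J ∪ K) (hJK.trans hIA) (by omega) S hSA hSJK)
    refine ⟨insert S (J ∪ K), insert_subset_insert S hJK, ?_, ?_⟩
    · rw [card_insert_of_notMem hSJK]
      omega
    · rw [card_insert_of_notMem hSJK, sup_insert, sup_comm, add_one_mul]
      omega

theorem HasNullityBound.exists_card_near_multiple [Nontrivial V]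
    (h : HasNullityBound F x r ε v μ u) (hx : span F (Set.range x) = ⊤)
    (hcov : ∀ i, ∃ S, i ∈ S ∧ IsVectorRepairSet F x r ε S) (hv : 0 < v) (hvr : v ≤ r) (hμ : μ ≤ ε)
    (hrμ : r + μ ≤ 2 * v + ε) (hvu : 2 * (r - v) < u) (hμu : μ ≤ u) :
    ∃ p, Fintype.card ι < p * (r + ε) + μ ∧ p * (r + ε) + v ≤ Fintype.card ι + r := by
  classical
  obtain ⟨A, hA, hirr₁, hcover⟩ := exists_isIrredundant_one_cover hx hcov
  have hirr := h.isIrredundant hv hvr hμ hrμ hA (by omega) hirr₁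
  rw [← card_univ, ← hcover]
  refine ⟨#A, ?_, ?_⟩
  · by_contra! hlarge
    obtain ⟨J, hJ, hJc, hunion⟩ := exists_subset_card_mul_add_le_card_biUnion (closureOn F x)
      (r + ε) A μ (by omega)
    have hrank := finrank_sup_spanOn_le_mul fun S hS => hA S (hJ hS)
    have hnull := h (J.sup (spanOn F x)) #J (by omega) (by omega)
    have hflat := card_le_card (biUnion_closureOn_subset_flat (F := F) x J)
    rw [mul_add] at hunion
    omega
  · by_contra! hsmall
    obtain ⟨J, hJ, hJc, hrank⟩ := hirr.exists_subset_finrank_sup_add_le hA Subset.rfl (r - v + 1)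
      (by omega) (by omega)
    have hfull := h.le_finrank_sup hvr hμ hA hirr hJ (by omega) (by omega)
    omega

end Counting

section UpperBound

variable {F : Type*} [Field F] {n : ℕ} {C : Submodule F (Fin n → F)} {d r ε μ u v : ℕ}

/-- The `i`-th coordinate as a linear functional on the code. -/
def coordFun (C : Submodule F (Fin n → F)) (i : Fin n) : Dual F C :=
  LinearMap.proj i ∘ₗ C.subtype

@[simp] lemma coordFun_apply (i : Fin n) (c : C) : coordFun C i c = (c : Fin n → F) i := rfl

lemma span_range_coordFun (C : Submodule F (Fin n → F)) : span F (Set.range (coordFun C)) = ⊤ := by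
  refine span_eq_top_of_ne_zero fun c hc => ?_
  by_contra! hzero
  exact hc (Subtype.ext (funext fun i => by simpa using hzero _ ⟨i, rfl⟩))

lemma IsRepairSet.isVectorRepairSet {S : Finset (Fin n)} (hS : IsRepairSet C r (ε + 1) S) :
    IsVectorRepairSet F (coordFun C) r ε S where
  card_le := hS.1
  spanOn_le L hL hLc := spanOn_le_iff.2 fun l hl => by
    by_cases hlL : l ∈ L
    · exact mem_spanOn hlL
    obtain ⟨a, ha⟩ := hS.2 l hl L (subset_erase.2 ⟨hL, hlL⟩) hLc
    have hcomb : coordFun C l = ∑ i ∈ L, a i • coordFun C i := by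
      ext c
      simpa using ha c c.2
    rw [hcomb]
    exact sum_mem fun i hi => smul_mem _ _ (mem_spanOn hi)

lemma HasLocality.exists_isVectorRepairSet (hC : HasLocality C r (ε + 1)) (i : Fin n) :
    ∃ S, i ∈ S ∧ IsVectorRepairSet F (coordFun C) r ε S :=
  (hC i).imp fun _ hS => ⟨hS.1, hS.2.isVectorRepairSet⟩

lemma IsMinDist.add_card_flat_le [DecidableEq F] (hd : IsMinDist C d) {W : Submodule F (Dual F C)}
    (hW : finrank F W < finrank F C) : d + #(flat (coordFun C) W) ≤ n := by
  have hdim := Subspace.finrank_add_finrank_dualCoannihilator_eq W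
  have hne : W.dualCoannihilator ≠ ⊥ := by
    intro hbot
    rw [hbot, finrank_bot] at hdim
    omega
  obtain ⟨c, hc, hc0⟩ := exists_mem_ne_zero_of_ne_bot hne
  have hdc : d ≤ hammingDist (c : Fin n → F) 0 :=
    hd.2 ⟨c, c.2, 0, zero_mem C, by simpa using hc0, rfl⟩
  have hsupp : hammingDist (c : Fin n → F) 0 ≤ #(flat (coordFun C) W)ᶜ := by
    refine card_le_card fun i hi => ?_
    rw [mem_compl, mem_flat]
    exact fun hiW => (mem_filter.1 hi).2 ((mem_dualCoannihilator c).1 hc _ hiW)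
  have hcompl := card_add_card_compl (flat (coordFun C) W)
  rw [Fintype.card_fin] at hcompl
  omega

lemma IsMinDist.hasNullityBound [DecidableEq F] (hd : IsMinDist C d)
    (hC : HasLocality C r (ε + 1)) (hk : finrank F C = u * r + v)
    (hlt : n + 1 < d + (u * r + v) + u * ε + μ) :
    HasNullityBound F (coordFun C) r ε v μ u := by
  intro W j hj hW
  obtain ⟨i, rfl⟩ := Nat.exists_eq_add_of_le hj
  have hx := span_range_coordFun C
  have hdual : finrank F (Dual F C) = (j + i) * r + v := by rw [Subspace.dual_finrank_eq, hk]
  rw [add_mul] at hdual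
  obtain ⟨W', hlow, hup, hnull⟩ :=
    exists_le_finrank_of_covered hx hC.exists_isVectorRepairSet i W (by omega)
  obtain ⟨H, hH, hnull'⟩ := exists_finrank_add_one_eq hx (W := W') (by omega)
  have hdist := hd.add_card_flat_le (W := H) (by rw [hk, add_mul]; omega)
  rw [add_mul, add_mul] at hlt
  omega

theorem IsMinDist.le_of_hasLocality [DecidableEq F] {w m : ℕ} (hd : IsMinDist C d)
    (hC : HasLocality C r (ε + 1)) (hk : finrank F C = u * r + v) (hn : n = w * (r + ε) + m)
    (hv : 0 < v) (hvr : v ≤ r) (hμ : μ ≤ ε) (hμm : μ ≤ m) (hm : m < v + ε)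
    (hrμ : r + μ ≤ 2 * v + ε) (hvu : 2 * (r - v) < u) (hμu : μ ≤ u) :
    d + (u * r + v) + u * ε + μ ≤ n + 1 := by
  by_contra! hlt
  have : Nontrivial (Dual F C) :=
    nontrivial_of_finrank_pos (R := F) (by rw [Subspace.dual_finrank_eq]; omega)
  obtain ⟨p, hnp, hpn⟩ := (hd.hasNullityBound hC hk hlt).exists_card_near_multiple
    (span_range_coordFun C) hC.exists_isVectorRepairSet hv hvr hμ hrμ hvu hμu
  rw [Fintype.card_fin, hn] at hnp hpn
  obtain hwp | hpw := Nat.lt_or_ge w p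
  · have hmul := Nat.mul_le_mul_right (r + ε) (Nat.succ_le_of_lt hwp)
    rw [Nat.succ_mul] at hmul
    omega
  · have hmul := Nat.mul_le_mul_right (r + ε) hpw
    omega

end UpperBound

section Gabidulin

open Polynomial

variable {E : Type*} [Field E] {k : ℕ}

/-- The linearized polynomial `∑ t, a t * X ^ q ^ t`. -/
noncomputable def linearizedPoly (q : ℕ) (a : Fin k → E) : E[X] :=
  ∑ t, C (a t) * X ^ q ^ (t : ℕ)

lemma eval_linearizedPoly (q : ℕ) (a : Fin k → E) (y : E) :
    (linearizedPoly q a).eval y = ∑ t, a t * y ^ q ^ (t : ℕ) := by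
  simp [linearizedPoly, eval_finsetSum]

lemma linearizedPoly_ne_zero {q : ℕ} (hq : 1 < q) {a : Fin k → E} (ha : a ≠ 0) :
    linearizedPoly q a ≠ 0 := by
  obtain ⟨s, hs⟩ := Function.ne_iff.1 ha
  intro hzero
  have hcoeff : (linearizedPoly q a).coeff (q ^ (s : ℕ)) = a s := by
    simp [linearizedPoly, coeff_X_pow, (Nat.pow_right_injective hq).eq_iff, Fin.val_inj]
  rw [hzero, coeff_zero] at hcoeff
  exact hs hcoeff.symm

lemma natDegree_linearizedPoly_le {q : ℕ} (hq : 0 < q) (a : Fin k → E) :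
    (linearizedPoly q a).natDegree ≤ q ^ (k - 1) :=
  natDegree_sum_le_of_forall_le _ _ fun t _ => (natDegree_C_mul_X_pow_le _ _).trans
    (Nat.pow_le_pow_right hq (by omega))

variable {K ι : Type*} [Field K] [Fintype K] [Algebra K E]

/-- Evaluation of the linearized polynomial with coefficients `a`, with `q` the order of `K`;
it is linear over `K`. -/
def linearizedEval (K : Type*) {E : Type*} [Field K] [Fintype K] [Field E] [Algebra K E] {k : ℕ} :
    (Fin k → E) →ₗ[E] E →ₗ[K] E :=
  Fintype.linearCombination E fun t => (FiniteField.frobeniusAlgHom K E ^ (t : ℕ)).toLinearMap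

lemma linearizedEval_apply (a : Fin k → E) (y : E) :
    linearizedEval K a y = ∑ t, a t * y ^ Fintype.card K ^ (t : ℕ) := by
  simp [linearizedEval, Fintype.linearCombination_apply, AlgHom.coe_pow,
    FiniteField.coe_frobeniusAlgHom, pow_iterate]

lemma finrank_ker_linearizedEval_lt [Finite E] {a : Fin k → E} (ha : a ≠ 0) :
    finrank K (LinearMap.ker (linearizedEval K a)) < k := by
  obtain ⟨s, -⟩ := Function.ne_iff.1 ha
  have hroots : ∀ y ∈ LinearMap.ker (linearizedEval K a),
      y ∈ (linearizedPoly (Fintype.card K) a).rootSet E := by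
    intro y hy
    rw [mem_rootSet, coe_aeval_eq_eval, eval_linearizedPoly, ← linearizedEval_apply]
    exact ⟨linearizedPoly_ne_zero Fintype.one_lt_card ha, hy⟩
  have hcard : Fintype.card K ^ finrank K (LinearMap.ker (linearizedEval K a)) ≤
      Fintype.card K ^ (k - 1) :=
    calc _ = Nat.card (LinearMap.ker (linearizedEval K a)) := by
          rw [Module.natCard_eq_pow_finrank (K := K), Nat.card_eq_fintype_card]
      _ ≤ ((linearizedPoly (Fintype.card K) a).rootSet E).ncard :=
          Set.ncard_le_ncard hroots (rootSet_finite _ E)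
      _ ≤ (linearizedPoly (Fintype.card K) a).natDegree := ncard_rootSet_le _ E
      _ ≤ _ := natDegree_linearizedPoly_le Fintype.card_pos a
  have hlt := (Nat.pow_le_pow_iff_right (Fintype.one_lt_card (α := K))).1 hcard
  have hk := s.pos
  omega

/-- The encoder of the Gabidulin code of dimension `k` with evaluation points `y`. -/
def gabidulinEncoder (K : Type*) {E ι : Type*} [Field K] [Fintype K] [Field E] [Algebra K E]
    (y : ι → E) (k : ℕ) : (Fin k → E) →ₗ[E] ι → E where
  toFun a i := linearizedEval K a (y i)
  map_add' a b := by ext; simp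
  map_smul' c a := by ext; simp

lemma gabidulinEncoder_apply (y : ι → E) (a : Fin k → E) (i : ι) :
    gabidulinEncoder K y k a i = linearizedEval K a (y i) := rfl

lemma eq_zero_of_gabidulinEncoder_eq_zero [Finite E] {y : ι → E} {a : Fin k → E} {T : Finset ι}
    (hT : k ≤ finrank K (spanOn K y T)) (ha : ∀ i ∈ T, gabidulinEncoder K y k a i = 0) :
    a = 0 := by
  by_contra hne
  have hker : spanOn K y T ≤ LinearMap.ker (linearizedEval K a) :=
    spanOn_le_iff.2 fun i hi => LinearMap.mem_ker.2 (ha i hi)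
  exact ((finrank_mono hker).trans_lt (finrank_ker_linearizedEval_lt hne)).not_ge hT

lemma finrank_range_gabidulinEncoder [Finite E] {y : ι → E} {T : Finset ι}
    (hT : k ≤ finrank K (spanOn K y T)) :
    finrank E (LinearMap.range (gabidulinEncoder K y k)) = k := by
  have hker : LinearMap.ker (gabidulinEncoder K y k) = ⊥ := LinearMap.ker_eq_bot'.2 fun a ha =>
    eq_zero_of_gabidulinEncoder_eq_zero hT fun i _ => congrFun ha i
  rw [LinearMap.finrank_range_of_inj (LinearMap.ker_eq_bot.1 hker), finrank_fin_fun]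

lemma card_lt_hammingNorm_add_of_mem_range_gabidulinEncoder [Finite E] [DecidableEq E] [Fintype ι]
    {y : ι → E} {N : ℕ} (hN : ∀ T : Finset ι, N ≤ #T → k ≤ finrank K (spanOn K y T)) {c : ι → E}
    (hc : c ∈ LinearMap.range (gabidulinEncoder K y k)) (hc0 : c ≠ 0) :
    Fintype.card ι < hammingNorm c + N := by
  obtain ⟨a, rfl⟩ := hc
  by_contra! hle
  refine hc0 ?_
  have hsplit : #{i | gabidulinEncoder K y k a i = 0} + hammingNorm (gabidulinEncoder K y k a) =
      Fintype.card ι := by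
    rw [← card_univ]
    exact card_filter_add_card_filter_not _
  rw [eq_zero_of_gabidulinEncoder_eq_zero
    (hN {i | gabidulinEncoder K y k a i = 0} (by omega))
    fun i hi => (mem_filter.1 hi).2, map_zero]

lemma IsVectorRepairSet.isRepairSet_range_gabidulinEncoder {n r ε : ℕ} {y : Fin n → E}
    {S : Finset (Fin n)} (hS : IsVectorRepairSet K y r ε S) :
    IsRepairSet (LinearMap.range (gabidulinEncoder K y k)) r (ε + 1) S := by
  refine ⟨hS.card_le, fun l hl L hL hLc => ?_⟩
  have hmem := hS.spanOn_le L (hL.trans (erase_subset l S)) hLc (mem_spanOn hl)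
  obtain ⟨c, hc⟩ := (mem_span_image_finset_iff_exists_fun K).1 hmem
  refine ⟨fun i => if h : i ∈ L then algebraMap K E (c ⟨i, h⟩) else 0, ?_⟩
  rintro _ ⟨a, rfl⟩
  simp only [gabidulinEncoder_apply]
  rw [← hc, map_sum, ← sum_coe_sort L]
  exact sum_congr rfl fun i _ => by rw [map_smul, Algebra.smul_def, dif_pos i.2]

end Gabidulin

section Blocks

variable {K β ι : Type*} [Field K] [DecidableEq β] {rk : β → ℕ} {blk : ι → β} {α : ι → K}

lemma linearIndependent_pow {κ : Type*} [Fintype κ] {α : κ → K} (hα : Function.Injective α) {m : ℕ}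
    (hm : Fintype.card κ ≤ m) : LinearIndependent K fun i (t : Fin m) => α i ^ (t : ℕ) := by
  refine Fintype.linearIndependent_iff.2 fun g hg i => ?_
  let e := Fintype.equivFin κ
  have hzero : g ∘ e.symm = 0 := by
    refine Matrix.eq_zero_of_forall_pow_sum_mul_pow_eq_zero (hα.comp e.symm.injective) fun t => ?_
    have ht := congrFun hg (t.castLE hm)
    simp only [Finset.sum_apply, Pi.smul_apply, smul_eq_mul, Fin.val_castLE, Pi.zero_apply] at ht
    rw [← ht]
    exact e.symm.sum_comp fun j => g j * α j ^ (t : ℕ)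
  simpa using congrFun hzero (e i)

/-- The configuration in a direct sum of Reed–Solomon spaces of dimensions `rk b` in which the
index `i` has the vector `(1, α i, α i ^ 2, …)` in the summand of its block `blk i`. -/
def blockVec (rk : β → ℕ) (blk : ι → β) (α : ι → K) (i : ι) : (b : β) → Fin (rk b) → K :=
  Pi.single (blk i) fun t => α i ^ (t : ℕ)

lemma linearIndepOn_blockVec (hα : Function.Injective α) {T : Finset ι}
    (hT : ∀ b, #{i ∈ T | blk i = b} ≤ rk b) :
    LinearIndepOn K (blockVec rk blk α) (T : Set ι) := by
  have hblock : ∀ b, LinearIndependent K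
      fun (i : {i // i ∈ ({i ∈ T | blk i = b} : Finset ι)}) (t : Fin (rk b)) => α i ^ (t : ℕ) :=
    fun b => linearIndependent_pow (hα.comp Subtype.val_injective)
      (by simpa only [Fintype.card_coe] using hT b)
  exact (Pi.linearIndependent_single _ hblock).comp
    (fun i : (T : Set ι) => ⟨blk i, i, mem_filter.2 ⟨i.2, rfl⟩⟩)
    fun _ _ hij => Subtype.ext (congrArg (fun z => (z.2 : ι)) hij)

lemma sum_min_le_finrank_spanOn_blockVec [Fintype β] (hα : Function.Injective α) (T : Finset ι) :
    ∑ b, min #{i ∈ T | blk i = b} (rk b) ≤ finrank K (spanOn K (blockVec rk blk α) T) := by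
  classical
  choose P hP hPc using fun b => exists_subset_card_eq (min_le_left #{i ∈ T | blk i = b} (rk b))
  have hblk : ∀ b, ∀ i ∈ P b, blk i = b := fun b i hi => (mem_filter.1 (hP b hi)).2
  have hPT : univ.biUnion P ⊆ T := biUnion_subset.2 fun b _ => (hP b).trans (filter_subset _ _)
  have hli : LinearIndepOn K (blockVec rk blk α) (univ.biUnion P : Finset ι) := by
    refine linearIndepOn_blockVec hα fun b => ?_
    have hsub : ({i ∈ univ.biUnion P | blk i = b} : Finset ι) ⊆ P b := fun i hi => by
      obtain ⟨hiP, rfl⟩ := mem_filter.1 hi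
      obtain ⟨b', -, hi'⟩ := mem_biUnion.1 hiP
      rwa [hblk b' i hi']
    exact (card_le_card hsub).trans ((hPc b).trans_le (min_le_right _ _))
  have hdisj : ∀ b ∈ univ, ∀ b' ∈ univ, b ≠ b' → Disjoint (P b) (P b') := fun b _ b' _ hne =>
    disjoint_left.2 fun i hi hi' => hne ((hblk b i hi).symm.trans (hblk b' i hi'))
  calc ∑ b, min #{i ∈ T | blk i = b} (rk b) = #(univ.biUnion P) := by
        rw [card_biUnion hdisj]
        exact sum_congr rfl fun b _ => (hPc b).symm
    _ = finrank K (spanOn K (blockVec rk blk α) (univ.biUnion P)) := by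
        rw [spanOn, Set.image_eq_range, finrank_span_eq_card hli]
        exact (Fintype.card_coe _).symm
    _ ≤ _ := finrank_mono (spanOn_mono hPT)

lemma finrank_spanOn_blockVec_le {S : Finset ι} {b : β} (hS : ∀ i ∈ S, blk i = b) :
    finrank K (spanOn K (blockVec rk blk α) S) ≤ rk b := by
  have hsingle : spanOn K (blockVec rk blk α) S ≤
      LinearMap.range (LinearMap.single K (fun b => Fin (rk b) → K) b) :=
    spanOn_le_iff.2 fun i hi => by
      obtain rfl := hS i hi
      exact ⟨_, rfl⟩
  calc _ ≤ finrank K (LinearMap.range (LinearMap.single K (fun b => Fin (rk b) → K) b)) :=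
        finrank_mono hsingle
    _ ≤ finrank K (Fin (rk b) → K) := LinearMap.finrank_range_le _
    _ = rk b := finrank_fin_fun K

lemma le_finrank_spanOn_blockVec [Finite β] (hα : Function.Injective α) {L : Finset ι} {b : β}
    (hL : ∀ i ∈ L, blk i = b) (hrk : rk b ≤ #L) :
    rk b ≤ finrank K (spanOn K (blockVec rk blk α) L) := by
  have := Fintype.ofFinite β
  have hLb : #{i ∈ L | blk i = b} = #L := by rw [filter_true_of_mem hL]
  calc rk b = min #{i ∈ L | blk i = b} (rk b) := by rw [hLb, min_eq_right hrk]
    _ ≤ ∑ b, min #{i ∈ L | blk i = b} (rk b) :=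
      single_le_sum_of_canonicallyOrdered (f := fun b => min #{i ∈ L | blk i = b} (rk b))
        (mem_univ b)
    _ ≤ finrank K (spanOn K (blockVec rk blk α) L) := sum_min_le_finrank_spanOn_blockVec hα L

lemma isVectorRepairSet_blockVec [Finite β] (hα : Function.Injective α) {r ε : ℕ} {S : Finset ι}
    {b : β} (hS : ∀ i ∈ S, blk i = b) (hc : #S ≤ r + ε) (hrk : rk b ≤ #S - ε) :
    IsVectorRepairSet K (blockVec rk blk α) r ε S where
  card_le := hc
  spanOn_le L hL hLc := by
    have hlow : rk b ≤ finrank K (spanOn K (blockVec rk blk α) L) :=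
      le_finrank_spanOn_blockVec hα (fun i hi => hS i (hL hi)) (hrk.trans_eq hLc.symm)
    have hup : finrank K (spanOn K (blockVec rk blk α) S) ≤ rk b := finrank_spanOn_blockVec_le hS
    exact (eq_of_le_of_finrank_le (spanOn_mono hL) (hup.trans hlow)).ge

end Blocks

section Construction

lemma exists_card_fiber_eq {β ι : Type*} [Fintype β] [DecidableEq β] [Fintype ι] (c : β → ℕ)
    (hc : ∑ b, c b = Fintype.card ι) : ∃ blk : ι → β, ∀ b, #{i | blk i = b} = c b := by
  classical
  let e : (Σ b, Fin (c b)) ≃ ι := Fintype.equivOfCardEq (by simp [hc])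
  refine ⟨fun i => (e.symm i).1, fun b => ?_⟩
  have hfiber : ({i | (e.symm i).1 = b} : Finset ι) = univ.image fun j => e ⟨b, j⟩ := by
    ext i
    simp only [mem_filter, mem_univ, true_and, mem_image]
    constructor
    · rintro rfl
      exact ⟨(e.symm i).2, e.apply_symm_apply i⟩
    · rintro ⟨j, rfl⟩
      rw [e.symm_apply_apply]
  rw [hfiber, card_image_of_injective _ fun j j' h => by simpa using h, card_univ,
    Fintype.card_fin]

lemma min_mul_le_sum_min {β : Type*} [Fintype β] {r ε : ℕ} {f : β → ℕ} (hf : ∀ b, f b ≤ r + ε)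
    (u : ℕ) : min ((u + 1) * r) (∑ b, f b - u * ε) ≤ ∑ b, min (f b) r := by
  obtain hmany | hfew := Nat.lt_or_ge u #{b | r < f b}
  · calc min ((u + 1) * r) (∑ b, f b - u * ε) ≤ (u + 1) * r := min_le_left _ _
      _ ≤ #{b | r < f b} * r := Nat.mul_le_mul_right r hmany
      _ = ∑ b with r < f b, min (f b) r := by
        rw [sum_congr rfl fun b hb => min_eq_right (mem_filter.1 hb).2.le, sum_const, smul_eq_mul]
      _ ≤ ∑ b, min (f b) r := sum_le_sum_of_subset (filter_subset _ _)
  · have hsum : ∑ b, f b ≤ ∑ b, min (f b) r + u * ε :=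
      calc ∑ b, f b ≤ ∑ b, (min (f b) r + if r < f b then ε else 0) :=
            sum_le_sum fun b _ => by
              have := hf b
              split_ifs <;> omega
        _ = ∑ b, min (f b) r + #{b | r < f b} * ε := by
            rw [sum_add_distrib, ← sum_filter, sum_const, smul_eq_mul]
        _ ≤ ∑ b, min (f b) r + u * ε := by gcongr
    omega

theorem exists_code_of_card_fiber {β : Type*} [Fintype β] [DecidableEq β] {n r ε k N : ℕ}
    (blk : Fin n → β) (rk : β → ℕ) (hcard : ∀ b, #{i | blk i = b} ≤ r + ε)
    (hrk : ∀ b, rk b ≤ #{i | blk i = b} - ε) (hk : 0 < k) (hNn : N ≤ n)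
    (hN : ∀ T : Finset (Fin n), N ≤ #T → k ≤ ∑ b, min #{i ∈ T | blk i = b} (rk b)) :
    ∃ (F : Type) (_ : Field F) (_ : Fintype F) (_ : DecidableEq F) (C : Submodule F (Fin n → F)),
      finrank F C = k ∧ HasLocality C r (ε + 1) ∧ ∀ c ∈ C, c ≠ 0 → n < hammingNorm c + N := by
  obtain ⟨p, hpn, hp⟩ := Nat.exists_infinite_primes n
  have : Fact p.Prime := ⟨hp⟩
  let E := GaloisField p (∑ b, rk b)
  have : Finite E := inferInstanceAs (Finite (GaloisField p (∑ b, rk b)))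
  let α : Fin n → ZMod p := fun i => ((i : ℕ) : ZMod p)
  have hα : Function.Injective α := fun i j hij => by
    have hmod := (ZMod.natCast_eq_natCast_iff' _ _ _).1 hij
    rwa [Nat.mod_eq_of_lt (by omega), Nat.mod_eq_of_lt (by omega), Fin.val_inj] at hmod
  have hrk0 : ∑ b, rk b ≠ 0 := by
    have hle := (hN univ (by simpa using hNn)).trans (sum_le_sum fun b _ => min_le_right _ (rk b))
    omega
  let φ : ((b : β) → Fin (rk b) → ZMod p) ≃ₗ[ZMod p] E := LinearEquiv.ofFinrankEq _ _ (by
    rw [GaloisField.finrank p hrk0, finrank_pi_fintype]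
    simp only [finrank_fin_fun])
  let y : Fin n → E := φ.toLinearMap ∘ blockVec rk blk α
  have hspan : ∀ T : Finset (Fin n), N ≤ #T → k ≤ finrank (ZMod p) (spanOn (ZMod p) y T) := by
    intro T hT
    rw [spanOn_comp, LinearEquiv.finrank_map_eq]
    exact (hN T hT).trans (sum_min_le_finrank_spanOn_blockVec hα T)
  classical
  refine ⟨E, inferInstance, Fintype.ofFinite E, inferInstance,
    LinearMap.range (gabidulinEncoder (ZMod p) y k),
    finrank_range_gabidulinEncoder (hspan univ (by simpa using hNn)), fun i => ?_,
    fun c hc hc0 => ?_⟩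
  · have hS := (isVectorRepairSet_blockVec hα (fun j hj => (mem_filter.1 hj).2) (hcard (blk i))
      (hrk (blk i))).comp φ.toLinearMap
    exact ⟨_, by simp, hS.isRepairSet_range_gabidulinEncoder⟩
  · simpa using card_lt_hammingNorm_add_of_mem_range_gabidulinEncoder hspan hc hc0

theorem exists_code_hasLocality {n r ε u v w m : ℕ} (hv : 0 < v) (hvr : v ≤ r)
    (hn : n = w * (r + ε) + m) (hm : m ≤ r + ε) (hkn : u * r + v + u * ε + min m ε ≤ n) :
    ∃ (F : Type) (_ : Field F) (_ : Fintype F) (_ : DecidableEq F) (C : Submodule F (Fin n → F)),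
      finrank F C = u * r + v ∧ HasLocality C r (ε + 1) ∧
        ∀ c ∈ C, c ≠ 0 → n < hammingNorm c + (u * r + v + u * ε + min m ε) := by
  obtain ⟨blk, hblk⟩ := exists_card_fiber_eq (ι := Fin n)
    (fun b : Option (Fin w) => b.elim m fun _ => r + ε) (by simp [hn, add_comm])
  refine exists_code_of_card_fiber blk (fun b => b.elim (m - ε) fun _ => r) (fun b => ?_)
    (fun b => ?_) (by omega) hkn fun T hT => ?_
  · rw [hblk]
    cases b
    exacts [hm, le_rfl]
  · rw [hblk]
    cases b <;> simp
  have hle : ∀ b, #{i ∈ T | blk i = b} ≤ b.elim m fun _ => r + ε := fun b =>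
    (card_le_card (filter_subset_filter _ (subset_univ T))).trans (hblk b).le
  have hfull := min_mul_le_sum_min (fun b => hle (some b)) u
  have hshort := hle none
  rw [card_eq_sum_card_fiberwise fun i _ => mem_univ (blk i), Fintype.sum_option] at hT
  rw [Fintype.sum_option]
  simp only [Option.elim_none, Option.elim_some] at hshort ⊢
  rw [add_one_mul] at hfull
  omega

end Construction

section MaximalDistance

variable {F : Type*} [Field F] [DecidableEq F] {n : ℕ} {C : Submodule F (Fin n → F)}

lemma exists_isMinDist (hC : C ≠ ⊥) : ∃ d, IsMinDist C d := by
  obtain ⟨c, hc, hc0⟩ := exists_mem_ne_zero_of_ne_bot hC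
  have hne : {t : ℕ | ∃ x ∈ C, ∃ y ∈ C, x ≠ y ∧ hammingDist x y = t}.Nonempty :=
    ⟨_, c, hc, 0, zero_mem C, hc0, rfl⟩
  exact ⟨_, Nat.sInf_mem hne, fun _ => Nat.sInf_le⟩

lemma IsMinDist.exists_hammingNorm_eq {d : ℕ} (hd : IsMinDist C d) :
    ∃ c ∈ C, c ≠ 0 ∧ hammingNorm c = d := by
  obtain ⟨x, hx, y, hy, hxy, rfl⟩ := hd.1
  exact ⟨-x + y, add_mem (neg_mem hx) hy, fun h => hxy (neg_add_eq_zero.1 h),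
    (hammingDist_eq_hammingNorm x y).symm⟩

lemma isDMax_of_forall_le {k r δ D : ℕ} (hk : 0 < k)
    (hle : ∀ (F : Type) [Field F] [Finite F] [DecidableEq F] (C : Submodule F (Fin n → F)) (d : ℕ),
      finrank F C = k → HasLocality C r δ → IsMinDist C d → d ≤ D)
    (hcode : ∃ (F : Type) (_ : Field F) (_ : Fintype F) (_ : DecidableEq F)
      (C : Submodule F (Fin n → F)),
      finrank F C = k ∧ HasLocality C r δ ∧ ∀ c ∈ C, c ≠ 0 → D ≤ hammingNorm c) :
    IsDMax n k r δ D := by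
  constructor
  · obtain ⟨F, _, _, _, C, hC, hloc, hweight⟩ := hcode
    obtain ⟨d, hd⟩ := exists_isMinDist (C := C) (by rintro rfl; simp [← hC] at hk)
    obtain ⟨c, hc, hc0, rfl⟩ := hd.exists_hammingNorm_eq
    refine ⟨F, _, inferInstance, _, C, _, hC, hloc, hd, ?_⟩
    exact_mod_cast le_antisymm (hweight c hc hc0) (hle F C _ hC hloc hd)
  · rintro _ ⟨F, _, _, _, C, d, hC, hloc, hd, rfl⟩
    exact_mod_cast hle F C d hC hloc hd

lemma ceil_mul_add_div {r u v : ℕ} (hv : 0 < v) (hvr : v ≤ r) :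
    ⌈((u * r + v : ℕ) : ℚ) / r⌉ = (u : ℤ) + 1 := by
  have hvq : (0 : ℚ) < v := by exact_mod_cast hv
  have hvrq : (v : ℚ) ≤ r := by exact_mod_cast hvr
  have hrq := hvq.trans_le hvrq
  rw [Int.ceil_eq_iff, lt_div_iff₀ hrq, div_le_iff₀ hrq]
  push_cast
  constructor <;> linarith

lemma lt_two_mul_of_floor_div_two_lt {r v : ℕ} (h : ⌊(r : ℚ) / 2⌋ < (v : ℤ)) : r < 2 * v := by
  rw [Int.floor_lt, div_lt_iff₀' two_pos] at h
  exact_mod_cast h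

end MaximalDistance

end LRC

theorem theorem2_general (n k r δ w m u v : ℕ) (hδ : 1 ≤ δ) (hn : n = w * (r + δ - 1) + m)
    (hk : k = u * r + v) (hv : 0 < v) (hvr : v ≤ r) (hm : m + 1 < v + δ)
    (hrv : r + min m (δ - 1) < 2 * v + δ) (hru : 2 * (r - v) < u) (hmu : min m (δ - 1) ≤ u)
    (hkn : (k : ℤ) ≤ n - ⌈(k : ℚ) / r⌉ * (δ - 1) + max 0 ((δ : ℤ) - 1 - m)) :
    LRC.IsDMax n k r δ (n - k + 1 - ⌈(k : ℚ) / r⌉ * (δ - 1) + max 0 ((δ : ℤ) - 1 - m)) := by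
  obtain ⟨ε, rfl⟩ := Nat.exists_eq_add_of_le' hδ
  simp only [← add_assoc, Nat.add_sub_cancel] at hn hrv hmu
  subst hk
  rw [LRC.ceil_mul_add_div hv hvr] at hkn ⊢
  have hε : ((u : ℤ) + 1) * (((ε + 1 : ℕ) : ℤ) - 1) = ((u * ε : ℕ) : ℤ) + ε := by push_cast; ring
  rw [hε] at hkn ⊢
  have hD : (n : ℤ) - ((u * r + v : ℕ) : ℤ) + 1 - (((u * ε : ℕ) : ℤ) + ε) +
      max 0 (((ε + 1 : ℕ) : ℤ) - 1 - m) = ((n + 1 - (u * r + v + u * ε + min m ε) : ℕ) : ℤ) := by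
    omega
  rw [hD]
  refine LRC.isDMax_of_forall_le (by omega) (fun F _ _ _ C d hC hloc hd => ?_) ?_
  · have hle := hd.le_of_hasLocality hloc hC hn hv hvr (min_le_right m ε) (min_le_left m ε)
      (by omega) (by omega) hru hmu
    omega
  · obtain ⟨F, _, _, _, C, hC, hloc, hweight⟩ :=
      LRC.exists_code_hasLocality (u := u) hv hvr hn (by omega) (by omega)
    refine ⟨F, ‹_›, ‹_›, ‹_›, C, hC, hloc, fun c hc hc0 => ?_⟩
    have hlt := hweight c hc hc0
    omega

theorem theorem2 (n k r δ w m u v : ℕ) (hδ : 2 ≤ δ)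
    (hn : n = w * (r + δ - 1) + m) (hm : m < r + δ - 1)
    (hk : k = u * r + v) (hv : 0 < v) (hvr : v ≤ r)
    (hm0 : 0 < m) (hvr' : v < r)
    (hr : 0 < r) (hrk : r < k)
    (hkn : (k : ℤ) ≤ (n : ℤ) - ⌈(k : ℚ) / (r : ℚ)⌉ * ((δ : ℤ) - 1))
    (hvm : max ((m : ℤ) - (δ : ℤ) + 1) ⌊(r : ℚ) / 2⌋ < (v : ℤ)) :
    (δ ≤ m →
      max (2 * ((r : ℤ) + (δ : ℤ) - 1 - (m : ℤ))) ((r : ℤ) + (δ : ℤ) - 1) ≤ (u : ℤ) →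
      LRC.IsDMax n k r δ
        ((n : ℤ) - (k : ℤ) + 1 - ⌈(k : ℚ) / (r : ℚ)⌉ * ((δ : ℤ) - 1))) ∧
    ((m : ℤ) ≤ (δ : ℤ) - 1 →
      2 * (r : ℤ) + (δ : ℤ) - 1 ≤ (u : ℤ) →
      LRC.IsDMax n k r δ
        ((n : ℤ) - (k : ℤ) + 1 - ⌈(k : ℚ) / (r : ℚ)⌉ * ((δ : ℤ) - 1)
          + ((δ : ℤ) - 1 - (m : ℤ)))) := by
  have hrv := LRC.lt_two_mul_of_floor_div_two_lt (max_lt_iff.1 hvm).2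
  constructor <;> intro hmδ hu <;>
    convert theorem2_general n k r δ w m u v ?_ hn hk hv hvr ?_ ?_ ?_ ?_ ?_ using 1 <;> omega
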